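/- Let $n\ge 0$. Let $\mathcal M_n$ be the space of all ordered triples $(\ell_1,\ell_2,\ell_3)$ of projective lines in $\mathbb{RP}^n$ such that each line of the triple intersects the two others in single points, and these two points are distinct; lines are identified with $2$-dimensional linear subspaces of $\mathbb R^{n+1}$, and $\mathcal M_n$ has the subspace topology from the product of three copies of the Grassmannian $\mathrm{Gr}(2,\mathbb R^{n+1})$. Let $\mathrm{Flag}(1,2,3;\mathbb R^{n+1})$ be the real partial flag variety of all flags $0\subset V_1\subset V_2\subset V_3\subset\mathbb R^{n+1}$ with $\dim V_i=i$ (signature $(0,1,2,3,n+1)$; for $n=2$ these are the complete flags of $\mathbb R^3$, and for $n\le 1$ both spaces are empty), with the subspace topology from the product of Grassmannians. Then $\mathcal M_n$ and $\mathrm{Flag}(1,2,3;\mathbb R^{n+1})$ are homotopy equivalent. More precisely, the following two maps are well defined and continuous, and are homotopy inverse to each other. The map $f:\mathcal M_n\to \mathrm{Flag}(1,2,3;\mathbb R^{n+1})$ sends $(\ell_1,\ell_2,\ell_3)$ to the flag $\langle e_1\rangle\subset\langle e_1,e_2\rangle\subset\langle e_1,e_2,e_3\rangle$, where $e_i$ is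 any nonzero vector orthogonal to $\ell_i$ in the $3$-dimensional subspace $\ell_1+\ell_2+\ell_3$ of $\mathbb R^{n+1}$. The map $g:\mathrm{Flag}(1,2,3;\mathbb R^{n+1})\to\mathcal M_n$ sends a flag $V_1\subset V_2\subset V_3$ to $(\ell_1,\ell_2,\ell_3)$, where $(e_1,e_2,e_3)$ is any orthonormal triple with $V_1=\langle e_1\rangle$, $V_2=\langle e_1,e_2\rangle$, $V_3=\langle e_1,e_2,e_3\rangle$, and $\ell_i$ is the orthogonal complement of $e_i$ in $V_3$. -/

import Mathlib

open ContinuousMap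
open scoped LinearAlgebra.Projectivization

noncomputable section

/-- Real projective space `ℝPⁿ` is the projectivization of this Euclidean space. -/
abbrev AmbientSpace (n : ℕ) : Type := EuclideanSpace ℝ (Fin (n + 1))

/-- The real Grassmannian of `k`-dimensional linear subspaces of `ℝⁿ⁺¹`. -/
def RealGrassmannian (k n : ℕ) : Type :=
  {W : Submodule ℝ (AmbientSpace n) // Module.finrank ℝ W = k}

namespace RealGrassmannian

variable {k n : ℕ}

/-- The underlying linear subspace. -/
def toSubmodule (W : RealGrassmannian k n) : Submodule ℝ (AmbientSpace n) := W.1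

/-- The usual topology of the Grassmannian: a subspace is identified with the orthogonal
projection onto it, an element of the normed space of operators (so the topology is that of
the gap metric `‖P_V - P_W‖`). It is the same as the quotient topology from orthonormal
`k`-frames, since these form a compact space and the set of projections is Hausdorff. -/
instance : TopologicalSpace (RealGrassmannian k n) :=
  TopologicalSpace.induced
    (fun W => (W.toSubmodule.starProjection : AmbientSpace n →L[ℝ] AmbientSpace n))
    inferInstance

/-- The set of points of `ℝPⁿ` lying on the projective subspace given by `W`. -/
def points (W : RealGrassmannian k n) : Set (ℙ ℝ (AmbientSpace n)) :=
  {P | P.submodule ≤ W.toSubmodule}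

end RealGrassmannian

/-- The space of projective lines in `ℝPⁿ`, that is, of `2`-dimensional subspaces of `ℝⁿ⁺¹`. -/
abbrev ProjLine (n : ℕ) : Type := RealGrassmannian 2 n

/-- `a` intersects `b` and `c` at distinct points of `ℝPⁿ`. -/
def ProjLine.MeetsAtDistinctPoints {n : ℕ} (a b c : ProjLine n) : Prop :=
  ∃ P Q : ℙ ℝ (AmbientSpace n), P ≠ Q ∧
    a.points ∩ b.points = {P} ∧ a.points ∩ c.points = {Q}

/-- The space of (ordered) triples of projective lines in `ℝPⁿ` such that each line of the triple
intersects the two others at distinct points, as a subspace of the triple product. -/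
abbrev LineTriples (n : ℕ) : Type :=
  {ℓ : Fin 3 → ProjLine n //
    (ℓ 0).MeetsAtDistinctPoints (ℓ 1) (ℓ 2) ∧
    (ℓ 1).MeetsAtDistinctPoints (ℓ 0) (ℓ 2) ∧
    (ℓ 2).MeetsAtDistinctPoints (ℓ 0) (ℓ 1)}

/-- The real partial flag variety `Flag(1,2,3; ℝⁿ⁺¹)`: flags `0 < V₁ < V₂ < V₃ ≤ ℝⁿ⁺¹` with
`dim Vᵢ = i`, as a subspace of the product of Grassmannians. -/
abbrev Flag123 (n : ℕ) : Type :=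
  {F : RealGrassmannian 1 n × RealGrassmannian 2 n × RealGrassmannian 3 n //
    F.1.toSubmodule ≤ F.2.1.toSubmodule ∧ F.2.1.toSubmodule ≤ F.2.2.toSubmodule}

namespace Flag123

variable {n : ℕ}

/-- The line `V₁` of the flag. -/
def V₁ (F : Flag123 n) : Submodule ℝ (AmbientSpace n) := F.1.1.toSubmodule

/-- The plane `V₂` of the flag. -/
def V₂ (F : Flag123 n) : Submodule ℝ (AmbientSpace n) := F.1.2.1.toSubmodule

/-- The `3`-space `V₃` of the flag. -/
def V₃ (F : Flag123 n) : Submodule ℝ (AmbientSpace n) := F.1.2.2.toSubmodule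

/-- `F` is the flag spanned successively by the vectors `e 0`, `e 1`, `e 2`. -/
def IsSpannedBy (F : Flag123 n) (e : Fin 3 → AmbientSpace n) : Prop :=
  F.V₁ = Submodule.span ℝ {e 0} ∧
  F.V₂ = Submodule.span ℝ {e 0, e 1} ∧
  F.V₃ = Submodule.span ℝ {e 0, e 1, e 2}

end Flag123

namespace LineTriples

variable {n : ℕ}

/-- The linear subspace of `ℝⁿ⁺¹` of the `i`-th line of the triple. -/
def line (p : LineTriples n) (i : Fin 3) : Submodule ℝ (AmbientSpace n) :=
  (p.1 i).toSubmodule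

/-- The linear subspace of `ℝⁿ⁺¹` spanned by the three lines (it is of dimension `3`). -/
def commonSpace (p : LineTriples n) : Submodule ℝ (AmbientSpace n) := ⨆ i, p.line i

/-- `e i` is a nonzero normal vector to the `i`-th line inside the common `3`-space. -/
def IsNormalFrame (p : LineTriples n) (e : Fin 3 → AmbientSpace n) : Prop :=
  ∀ i, e i ≠ 0 ∧ e i ∈ p.commonSpace ∧ e i ∈ (p.line i)ᗮ

end LineTriples

end

/-! Orthogonal duality inside the common 3-space turns a triangle of lines into three linearly
independent points, and back. `normals` and `toTriple` are continuous mutually inverse maps between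
`LineTriples` and `IndependentPoints`, so it remains to compare independent triples with flags.
`toFlag` takes successive spans, and `frame` splits a flag into orthogonal lines. `toFlag ∘ frame`
is the identity (`toFlag_frame`), while `frame ∘ toFlag` is Gram-Schmidt (`frame_toFlag`).
Subtracting only `t` times each projection joins it to the identity, and the partial spans never
change, so independence persists. Continuity is checked on orthogonal projections: relative
complements are differences of projections, and spans are built one dimension at a time. -/

namespace Submodule

/-! ### Relative orthogonal complements and tilts. -/

variable {E : Type*} [NormedAddCommGroup E] [InnerProductSpace ℝ E] [FiniteDimensional ℝ E]

theorem finrank_inf_orthogonal_add_finrank {U V : Submodule ℝ E} (h : U ≤ V) :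
    Module.finrank ℝ (V ⊓ Uᗮ : Submodule ℝ E) + Module.finrank ℝ U = Module.finrank ℝ V := by
  rw [inf_comm, add_comm]
  exact finrank_add_inf_finrank_orthogonal h

theorem sup_inf_orthogonal {U V : Submodule ℝ E} (h : U ≤ V) : U ⊔ V ⊓ Uᗮ = V := by
  rw [inf_comm]
  exact sup_orthogonal_inf_of_hasOrthogonalProjection h

theorem inf_orthogonal_inf_orthogonal {U V : Submodule ℝ E} (h : U ≤ V) :
    V ⊓ (V ⊓ Uᗮ)ᗮ = U := by
  refine (eq_of_le_of_finrank_eq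
    (le_inf h ((le_orthogonal_orthogonal U).trans (orthogonal_le inf_le_right))) ?_).symm
  have h₁ := finrank_inf_orthogonal_add_finrank h
  have h₂ := finrank_inf_orthogonal_add_finrank (inf_le_left : V ⊓ Uᗮ ≤ V)
  omega

theorem starProjection_inf_orthogonal {U V : Submodule ℝ E} (h : U ≤ V) :
    (V ⊓ Uᗮ).starProjection = V.starProjection - U.starProjection := by
  ext x : 1
  refine eq_starProjection_of_mem_orthogonal ?_ ?_
  · refine mem_inf.2 ⟨V.sub_mem (V.starProjection_apply_mem x)
      (h (U.starProjection_apply_mem x)), ?_⟩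
    have h₁ := U.sub_starProjection_mem_orthogonal x
    have h₂ := orthogonal_le h (V.sub_starProjection_mem_orthogonal x)
    convert Uᗮ.sub_mem h₁ h₂ using 1
    simp
  · have h₁ := orthogonal_le (inf_le_left : V ⊓ Uᗮ ≤ V) (V.sub_starProjection_mem_orthogonal x)
    have h₂ := orthogonal_le (inf_le_right : V ⊓ Uᗮ ≤ Uᗮ)
      (le_orthogonal_orthogonal U (U.starProjection_apply_mem x))
    convert (V ⊓ Uᗮ)ᗮ.add_mem h₁ h₂ using 1
    simp [sub_add]

/-- The subspace `m` moved towards the orthogonal complement of `U`: it is `m` for `t = 0`,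
and its orthogonal projection to `Uᗮ` for `t = 1`. -/
noncomputable def tilt (t : ℝ) (U m : Submodule ℝ E) : Submodule ℝ E :=
  m.map (ContinuousLinearMap.id ℝ E - t • U.starProjection : E →L[ℝ] E).toLinearMap

theorem sub_smul_starProjection_mem_tilt (t : ℝ) (U : Submodule ℝ E) {m : Submodule ℝ E} {x : E}
    (hx : x ∈ m) : x - t • U.starProjection x ∈ tilt t U m :=
  ⟨x, hx, by simp⟩

@[simp]
theorem tilt_zero (U m : Submodule ℝ E) : tilt 0 U m = m := by
  ext x
  simp [tilt]

/-- Tilting changes a vector only by an element of `U`. This is what keeps deformed triples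
independent for every `t`. -/
theorem sup_tilt (t : ℝ) (U m : Submodule ℝ E) : U ⊔ tilt t U m = U ⊔ m := by
  apply le_antisymm
  · refine sup_le le_sup_left ?_
    rintro _ ⟨x, hx, rfl⟩
    exact sub_mem (mem_sup_right hx)
      (mem_sup_left (U.smul_mem t (U.starProjection_apply_mem x)))
  · refine sup_le le_sup_left fun x hx => ?_
    rw [← sub_add_cancel x (t • U.starProjection x)]
    exact add_mem (mem_sup_right (sub_smul_starProjection_mem_tilt t U hx))
      (mem_sup_left (U.smul_mem t (U.starProjection_apply_mem x)))

theorem tilt_one (U m : Submodule ℝ E) : tilt 1 U m = (U ⊔ m) ⊓ Uᗮ := by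
  apply le_antisymm
  · refine le_inf (le_sup_right.trans (sup_tilt 1 U m).le) ?_
    rintro _ ⟨x, -, rfl⟩
    simp
  · rintro v ⟨hv, hv'⟩
    obtain ⟨u, hu, x, hx, rfl⟩ := mem_sup.1 hv
    refine ⟨x, hx, ?_⟩
    -- Orthogonality of `u + x` to `U` forces the projection of `x` to be `-u`, so `x` minus its
    -- projection is `u + x`.
    have h₁ : U.starProjection (u + x) = 0 := (starProjection_apply_eq_zero_iff U).2 hv'
    rw [map_add, starProjection_eq_self_iff.2 hu, add_eq_zero_iff_neg_eq] at h₁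
    simp [← h₁, add_comm]

theorem finrank_tilt_le (t : ℝ) (U m : Submodule ℝ E) :
    Module.finrank ℝ (tilt t U m) ≤ Module.finrank ℝ m :=
  finrank_map_le _ _

theorem eq_span_singleton_of_finrank_eq_one {m : Submodule ℝ E} (hm : Module.finrank ℝ m = 1)
    {v : E} (hv : v ∈ m) (hv₀ : v ≠ 0) : m = ℝ ∙ v :=
  (eq_of_le_of_finrank_eq ((span_singleton_le_iff_mem v m).2 hv)
    ((finrank_span_singleton hv₀).trans hm.symm)).symm

end Submodule

/-! ### Continuity of families of subspaces. -/

section Continuity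

variable {X E : Type*} [TopologicalSpace X] [NormedAddCommGroup E] [InnerProductSpace ℝ E]
  [FiniteDimensional ℝ E]

/-- A family of one-dimensional subspaces is continuous if it is the family of ranges of a
continuous family of operators. -/
theorem continuous_starProjection_of_finrank_eq_one {m : X → Submodule ℝ E}
    (hm : ∀ x, Module.finrank ℝ (m x) = 1) {A : X → E →L[ℝ] E} (hA : Continuous A)
    (hAm : ∀ x w, A x w ∈ m x) (hA₀ : ∀ x, A x ≠ 0) :
    Continuous fun x => (m x).starProjection := by
  refine continuous_iff_continuousAt.2 fun x => ?_
  -- For `y` near `x`, the vector `s = A y w` is nonzero and spans the line `m y`, whose projection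
  -- is `v ↦ ‖s‖⁻² ⟪s, v⟫ s`.
  obtain ⟨w, hw⟩ : ∃ w, A x w ≠ 0 := by
    by_contra! h
    exact hA₀ x (ContinuousLinearMap.ext h)
  have hs : Continuous fun y => A y w := hA.clm_apply continuous_const
  have hne : ∀ᶠ y in nhds x, A y w ≠ 0 := hs.continuousAt.eventually_ne hw
  have hcont : ContinuousAt
      (fun y => (‖A y w‖ ^ 2)⁻¹ • (innerSL ℝ (A y w)).smulRight (A y w)) x := by
    refine ((hs.norm.pow 2).continuousAt.inv₀ (by simpa using hw)).smul ?_
    refine Continuous.continuousAt ?_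
    have h₁ : Continuous fun y => innerSL ℝ (A y w) := (innerSL ℝ).continuous.comp hs
    exact ((ContinuousLinearMap.smulRightL ℝ E E).continuous.comp h₁).clm_apply hs
  refine hcont.congr ?_
  filter_upwards [hne] with y hy
  have : m y = ℝ ∙ A y w := Submodule.eq_span_singleton_of_finrank_eq_one (hm y) (hAm y w) hy
  rw [this]
  ext1 v
  rw [Submodule.starProjection_singleton]
  simp [div_eq_inv_mul, mul_smul]

theorem continuous_starProjection_inf_orthogonal {U V : X → Submodule ℝ E}
    (hU : Continuous fun x => (U x).starProjection)
    (hV : Continuous fun x => (V x).starProjection) (h : ∀ x, U x ≤ V x) :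
    Continuous fun x => (V x ⊓ (U x)ᗮ).starProjection := by
  simp_rw [fun x => Submodule.starProjection_inf_orthogonal (h x)]
  exact hV.sub hU

theorem continuous_starProjection_tilt {t : X → ℝ} {U m : X → Submodule ℝ E}
    (ht : Continuous t) (hU : Continuous fun x => (U x).starProjection)
    (hm : Continuous fun x => (m x).starProjection)
    (h₁ : ∀ x, Module.finrank ℝ (Submodule.tilt (t x) (U x) (m x)) = 1) :
    Continuous fun x => (Submodule.tilt (t x) (U x) (m x)).starProjection := by
  -- The tilt is the range of this composite; if the operator vanished, the tilt would be `⊥`.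
  refine continuous_starProjection_of_finrank_eq_one h₁
    (A := fun x => (ContinuousLinearMap.id ℝ E - t x • (U x).starProjection) ∘L
      (m x).starProjection) ((continuous_const.sub (ht.smul hU)).clm_comp hm) ?_ ?_
  · exact fun x w => Submodule.sub_smul_starProjection_mem_tilt _ _
      ((m x).starProjection_apply_mem w)
  · intro x h₀
    have : Submodule.tilt (t x) (U x) (m x) = ⊥ := by
      refine eq_bot_iff.2 ?_
      rintro _ ⟨v, hv, rfl⟩
      have := DFunLike.congr_fun h₀ v
      simpa [Submodule.starProjection_eq_self_iff.2 hv] using this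
    have h := h₁ x
    rw [this, finrank_bot] at h
    exact zero_ne_one h

/-- If a sum of two continuous families exceeds the first one by a single dimension, then it is
continuous. -/
theorem continuous_starProjection_sup {U W : X → Submodule ℝ E}
    (hU : Continuous fun x => (U x).starProjection)
    (hW : Continuous fun x => (W x).starProjection)
    (h : ∀ x, Module.finrank ℝ (U x ⊔ W x : Submodule ℝ E) = Module.finrank ℝ (U x) + 1) :
    Continuous fun x => (U x ⊔ W x).starProjection := by
  have h₁ : ∀ x, Module.finrank ℝ (Submodule.tilt 1 (U x) (W x)) = 1 := fun x => by
    have := Submodule.finrank_inf_orthogonal_add_finrank (le_sup_left : U x ≤ U x ⊔ W x)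
    rw [Submodule.tilt_one]
    have := h x
    omega
  -- `U ⊔ W` is the orthogonal sum of `U` and the line `tilt 1 U W`, so its projection is the sum of
  -- theirs.
  have h₂ := hU.add (continuous_starProjection_tilt continuous_const hU hW h₁)
  refine h₂.congr fun x => ?_
  simp [Submodule.tilt_one, Submodule.starProjection_inf_orthogonal]

end Continuity

/-! ### Linear algebra of triangles. -/

section Triangle

variable {E : Type*} [AddCommGroup E] [Module ℝ E] [FiniteDimensional ℝ E]

/-- If three planes span a `3`-space and have no common line, then any two of them meet in a
line. -/
theorem Submodule.finrank_inf_eq_one_of_finrank_sup_eq_three {A B C : Submodule ℝ E}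
    (hA : Module.finrank ℝ A = 2) (hB : Module.finrank ℝ B = 2) (hC : Module.finrank ℝ C = 2)
    (hsup : Module.finrank ℝ (A ⊔ B ⊔ C : Submodule ℝ E) = 3) (hinf : A ⊓ B ⊓ C = ⊥) :
    Module.finrank ℝ (A ⊓ B : Submodule ℝ E) = 1 := by
  -- `A ⊔ B` inside a 3-space makes `A ⊓ B` at least a line; `A ⊓ B ⊔ C`, a direct sum, makes it at
  -- most one.
  have h₁ := Submodule.finrank_sup_add_finrank_inf_eq A B
  have h₂ := Submodule.finrank_sup_add_finrank_inf_eq (A ⊓ B) C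
  have h₃ : Module.finrank ℝ (A ⊔ B : Submodule ℝ E) ≤ 3 :=
    hsup ▸ Submodule.finrank_mono le_sup_left
  have h₄ : Module.finrank ℝ (A ⊓ B ⊔ C : Submodule ℝ E) ≤ 3 :=
    hsup ▸ Submodule.finrank_mono (sup_le_sup_right (inf_le_left.trans le_sup_left) C)
  rw [hinf, finrank_bot] at h₂
  omega

/-- The independent lines `A ⊓ C` and `B ⊓ C` span `C`, so `C ≤ A ⊔ B`, which has dimension `2 + 2 -
1`. -/
theorem Submodule.finrank_sup_eq_three_of_finrank_inf_eq_one {A B C : Submodule ℝ E}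
    (hA : Module.finrank ℝ A = 2) (hB : Module.finrank ℝ B = 2) (hC : Module.finrank ℝ C = 2)
    (hAB : Module.finrank ℝ (A ⊓ B : Submodule ℝ E) = 1)
    (hAC : Module.finrank ℝ (A ⊓ C : Submodule ℝ E) = 1)
    (hBC : Module.finrank ℝ (B ⊓ C : Submodule ℝ E) = 1) (hinf : A ⊓ B ⊓ C = ⊥) :
    Module.finrank ℝ (A ⊔ B ⊔ C : Submodule ℝ E) = 3 := by
  have h₁ := Submodule.finrank_sup_add_finrank_inf_eq A B
  have h₂ := Submodule.finrank_sup_add_finrank_inf_eq (A ⊓ C) (B ⊓ C)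
  rw [← inf_inf_distrib_right, hinf, finrank_bot] at h₂
  have h₃ : A ⊓ C ⊔ B ⊓ C = C :=
    Submodule.eq_of_le_of_finrank_eq (sup_le inf_le_right inf_le_right) (by omega)
  have h₄ : C ≤ A ⊔ B := h₃ ▸ sup_le_sup inf_le_left inf_le_left
  rw [sup_eq_left.2 h₄]
  omega

/-- Distinct lines meet trivially. Distinctness of vertices thus becomes a condition symmetric in
the three planes. -/
theorem Submodule.inf_ne_inf_iff {A B C : Submodule ℝ E}
    (hAB : Module.finrank ℝ (A ⊓ B : Submodule ℝ E) = 1)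
    (hAC : Module.finrank ℝ (A ⊓ C : Submodule ℝ E) = 1) :
    A ⊓ B ≠ A ⊓ C ↔ A ⊓ B ⊓ C = ⊥ := by
  refine ⟨fun h => ?_, fun h h' => ?_⟩
  · by_contra h₀
    have h₁ : 0 < Module.finrank ℝ (A ⊓ B ⊓ C : Submodule ℝ E) :=
      Nat.pos_of_ne_zero fun h₂ => h₀ (Submodule.finrank_eq_zero.1 h₂)
    have h₂ : A ⊓ B ⊓ C = A ⊓ B := Submodule.eq_of_le_of_finrank_le inf_le_left (by omega)
    have h₃ : A ⊓ B ⊓ C = A ⊓ C :=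
      Submodule.eq_of_le_of_finrank_le (inf_le_inf_right C inf_le_left) (by omega)
    exact h (h₂.symm.trans h₃)
  · have h₁ : A ⊓ B ⊓ C = A ⊓ B := inf_eq_left.2 (h'.le.trans inf_le_right)
    rw [← h₁, h, finrank_bot] at hAB
    exact zero_ne_one hAB

end Triangle

theorem RealGrassmannian.points_inter_points_eq_singleton_iff {k l n : ℕ}
    (a : RealGrassmannian k n) (b : RealGrassmannian l n) (P : ℙ ℝ (AmbientSpace n)) :
    a.points ∩ b.points = {P} ↔ a.toSubmodule ⊓ b.toSubmodule = P.submodule := by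
  have key : ∀ Q, Q ∈ a.points ∩ b.points ↔ Q.submodule ≤ a.toSubmodule ⊓ b.toSubmodule :=
    fun Q => by rw [le_inf_iff]; rfl
  refine ⟨fun h => le_antisymm (fun v hv => ?_) ?_, fun h => ?_⟩
  · rcases eq_or_ne v 0 with rfl | hv₀
    · exact zero_mem _
    · have : Projectivization.mk ℝ v hv₀ ∈ a.points ∩ b.points := by
        rw [key, Projectivization.submodule_mk, Submodule.span_singleton_le_iff_mem]
        exact hv
      rw [h, Set.mem_singleton_iff] at this
      rw [← this, Projectivization.submodule_mk]
      exact Submodule.mem_span_singleton_self v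
  · rw [← key, h]
    rfl
  · ext Q
    rw [key, h, Set.mem_singleton_iff]
    refine ⟨fun hQ => Projectivization.submodule_injective ?_, fun hQ => hQ ▸ le_rfl⟩
    exact Submodule.eq_of_le_of_finrank_eq hQ
      (Q.finrank_submodule.trans P.finrank_submodule.symm)

namespace ProjLine

variable {n : ℕ}

theorem meetsAtDistinctPoints_iff (a b c : ProjLine n) :
    a.MeetsAtDistinctPoints b c ↔
      Module.finrank ℝ (a.toSubmodule ⊓ b.toSubmodule : Submodule ℝ (AmbientSpace n)) = 1 ∧
      Module.finrank ℝ (a.toSubmodule ⊓ c.toSubmodule : Submodule ℝ (AmbientSpace n)) = 1 ∧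
      a.toSubmodule ⊓ b.toSubmodule ⊓ c.toSubmodule = ⊥ := by
  constructor
  · rintro ⟨P, Q, hPQ, hP, hQ⟩
    rw [RealGrassmannian.points_inter_points_eq_singleton_iff] at hP hQ
    have h₁ := hP ▸ P.finrank_submodule
    have h₂ := hQ ▸ Q.finrank_submodule
    refine ⟨h₁, h₂, (Submodule.inf_ne_inf_iff h₁ h₂).1 fun h => hPQ ?_⟩
    exact Projectivization.submodule_injective (hP.symm.trans (h.trans hQ))
  · rintro ⟨h₁, h₂, h⟩
    refine ⟨.mk'' _ h₁, .mk'' _ h₂, fun h' => (Submodule.inf_ne_inf_iff h₁ h₂).2 h ?_, ?_, ?_⟩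
    · simpa using congrArg Projectivization.submodule h'
    · simp [RealGrassmannian.points_inter_points_eq_singleton_iff]
    · simp [RealGrassmannian.points_inter_points_eq_singleton_iff]

/-- Three projective lines form a triangle if and only if they span a projective plane and have
no common point. -/
theorem forms_triangle_iff (ℓ : Fin 3 → ProjLine n) :
    ((ℓ 0).MeetsAtDistinctPoints (ℓ 1) (ℓ 2) ∧ (ℓ 1).MeetsAtDistinctPoints (ℓ 0) (ℓ 2) ∧
      (ℓ 2).MeetsAtDistinctPoints (ℓ 0) (ℓ 1)) ↔
    Module.finrank ℝ ((ℓ 0).toSubmodule ⊔ (ℓ 1).toSubmodule ⊔ (ℓ 2).toSubmodule :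
      Submodule ℝ (AmbientSpace n)) = 3 ∧
    (ℓ 0).toSubmodule ⊓ (ℓ 1).toSubmodule ⊓ (ℓ 2).toSubmodule = ⊥ := by
  simp only [meetsAtDistinctPoints_iff]
  have h₀ : Module.finrank ℝ (ℓ 0).toSubmodule = 2 := (ℓ 0).2
  have h₁ : Module.finrank ℝ (ℓ 1).toSubmodule = 2 := (ℓ 1).2
  have h₂ : Module.finrank ℝ (ℓ 2).toSubmodule = 2 := (ℓ 2).2
  generalize (ℓ 0).toSubmodule = A at *
  generalize (ℓ 1).toSubmodule = B at *
  generalize (ℓ 2).toSubmodule = C at *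
  constructor
  · rintro ⟨⟨hAB, hAC, h⟩, ⟨-, hBC, -⟩, -⟩
    exact ⟨Submodule.finrank_sup_eq_three_of_finrank_inf_eq_one h₀ h₁ h₂ hAB hAC hBC h, h⟩
  · rintro ⟨hsup, h⟩
    have hsup' : Module.finrank ℝ (A ⊔ C ⊔ B : Submodule ℝ (AmbientSpace n)) = 3 := by
      rwa [sup_right_comm]
    have hsup'' : Module.finrank ℝ (B ⊔ C ⊔ A : Submodule ℝ (AmbientSpace n)) = 3 := by
      rwa [sup_comm, ← sup_assoc]
    have h' : A ⊓ C ⊓ B = ⊥ := by rwa [inf_right_comm]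
    have h'' : B ⊓ C ⊓ A = ⊥ := by rwa [inf_comm, ← inf_assoc]
    have hAB := Submodule.finrank_inf_eq_one_of_finrank_sup_eq_three h₀ h₁ h₂ hsup h
    have hAC := Submodule.finrank_inf_eq_one_of_finrank_sup_eq_three h₀ h₂ h₁ hsup' h'
    have hBC := Submodule.finrank_inf_eq_one_of_finrank_sup_eq_three h₁ h₂ h₀ hsup'' h''
    refine ⟨⟨hAB, hAC, h⟩, ⟨?_, hBC, ?_⟩, ?_, ?_, ?_⟩
    · rwa [inf_comm]
    · rwa [inf_comm B A]
    · rwa [inf_comm]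
    · rwa [inf_comm]
    · rwa [inf_comm C A]

end ProjLine

/-! ### Independent triples, their flags and dual triangles, and the Gram-Schmidt deformation. -/

noncomputable section

namespace RealGrassmannian

variable {k n : ℕ}

theorem continuous_iff {X : Type*} [TopologicalSpace X] {W : X → RealGrassmannian k n} :
    Continuous W ↔ Continuous fun x =>
      ((W x).toSubmodule.starProjection : AmbientSpace n →L[ℝ] AmbientSpace n) :=
  continuous_induced_rng

theorem finrank_toSubmodule (W : RealGrassmannian k n) : Module.finrank ℝ W.toSubmodule = k :=
  W.2

end RealGrassmannian

/-- The space of ordered triples of linearly independent points of `ℝPⁿ`, regarded as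
one-dimensional subspaces. -/
structure IndependentPoints (n : ℕ) where
  /-- The points. -/
  point : Fin 3 → Submodule ℝ (AmbientSpace n)
  finrank_point : ∀ i, Module.finrank ℝ (point i) = 1
  finrank_sup : Module.finrank ℝ (point 0 ⊔ point 1 ⊔ point 2 :
    Submodule ℝ (AmbientSpace n)) = 3

namespace IndependentPoints

variable {n : ℕ}

instance : TopologicalSpace (IndependentPoints n) :=
  TopologicalSpace.induced (fun K i =>
    ((K.point i).starProjection : AmbientSpace n →L[ℝ] AmbientSpace n)) inferInstance

theorem continuous_iff {X : Type*} [TopologicalSpace X] {K : X → IndependentPoints n} :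
    Continuous K ↔ ∀ i, Continuous fun x =>
      (((K x).point i).starProjection : AmbientSpace n →L[ℝ] AmbientSpace n) :=
  continuous_induced_rng.trans continuous_pi_iff

theorem continuous_starProjection_point (i : Fin 3) :
    Continuous fun K : IndependentPoints n =>
      ((K.point i).starProjection : AmbientSpace n →L[ℝ] AmbientSpace n) :=
  continuous_iff.1 continuous_id i

theorem ext_point {K L : IndependentPoints n} (h : ∀ i, K.point i = L.point i) : K = L := by
  cases K
  cases L
  simpa only [IndependentPoints.mk.injEq] using funext h

/-- The span of the three points. -/
def space (K : IndependentPoints n) : Submodule ℝ (AmbientSpace n) :=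
  K.point 0 ⊔ K.point 1 ⊔ K.point 2

theorem finrank_space (K : IndependentPoints n) : Module.finrank ℝ K.space = 3 :=
  K.finrank_sup

theorem point_le_space (K : IndependentPoints n) (i : Fin 3) : K.point i ≤ K.space := by
  fin_cases i
  · exact le_sup_left.trans le_sup_left
  · exact le_sup_right.trans le_sup_left
  · exact le_sup_right

theorem finrank_sup_zero_one (K : IndependentPoints n) :
    Module.finrank ℝ (K.point 0 ⊔ K.point 1 : Submodule ℝ (AmbientSpace n)) = 2 := by
  have h₁ := Submodule.finrank_add_le_finrank_add_finrank (K.point 0) (K.point 1)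
  have h₂ := Submodule.finrank_add_le_finrank_add_finrank (K.point 0 ⊔ K.point 1) (K.point 2)
  have := K.finrank_point 0
  have := K.finrank_point 1
  have := K.finrank_point 2
  have := K.finrank_sup
  omega

theorem continuous_starProjection_sup_zero_one :
    Continuous fun K : IndependentPoints n =>
      ((K.point 0 ⊔ K.point 1).starProjection : AmbientSpace n →L[ℝ] AmbientSpace n) :=
  continuous_starProjection_sup (continuous_starProjection_point 0)
    (continuous_starProjection_point 1) fun K => by
      rw [K.finrank_sup_zero_one, K.finrank_point]

theorem continuous_starProjection_space :
    Continuous fun K : IndependentPoints n =>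
      (K.space.starProjection : AmbientSpace n →L[ℝ] AmbientSpace n) :=
  continuous_starProjection_sup continuous_starProjection_sup_zero_one
    (continuous_starProjection_point 2) fun K => by
      rw [K.finrank_sup_zero_one, K.finrank_sup]

/-- The flag spanned successively by the points. -/
def toFlag (K : IndependentPoints n) : Flag123 n :=
  ⟨(⟨K.point 0, K.finrank_point 0⟩, ⟨K.point 0 ⊔ K.point 1, K.finrank_sup_zero_one⟩,
    ⟨K.space, K.finrank_space⟩), le_sup_left, le_sup_left⟩

theorem continuous_toFlag : Continuous (toFlag (n := n)) := by
  have h₁ : Continuous fun K : IndependentPoints n => K.toFlag.1.1 :=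
    RealGrassmannian.continuous_iff.2 (continuous_starProjection_point 0)
  have h₂ : Continuous fun K : IndependentPoints n => K.toFlag.1.2.1 :=
    RealGrassmannian.continuous_iff.2 continuous_starProjection_sup_zero_one
  have h₃ : Continuous fun K : IndependentPoints n => K.toFlag.1.2.2 :=
    RealGrassmannian.continuous_iff.2 continuous_starProjection_space
  exact continuous_induced_rng.2 (h₁.prodMk (h₂.prodMk h₃))

/-- The line dual to the `i`-th point inside the plane spanned by all of them. -/
def dualLine (K : IndependentPoints n) (i : Fin 3) : ProjLine n :=
  ⟨K.space ⊓ (K.point i)ᗮ, by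
    have h₁ := Submodule.finrank_inf_orthogonal_add_finrank (K.point_le_space i)
    have h₂ := K.finrank_point i
    have h₃ := K.finrank_space
    omega⟩

theorem toSubmodule_dualLine (K : IndependentPoints n) (i : Fin 3) :
    (K.dualLine i).toSubmodule = K.space ⊓ (K.point i)ᗮ := rfl

theorem dualLine_inf_eq_bot (K : IndependentPoints n) :
    (K.dualLine 0).toSubmodule ⊓ (K.dualLine 1).toSubmodule ⊓ (K.dualLine 2).toSubmodule = ⊥ := by
  simp only [toSubmodule_dualLine]
  rw [← inf_inf_distrib_left, ← inf_inf_distrib_left, Submodule.inf_orthogonal,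
    Submodule.inf_orthogonal]
  exact Submodule.inf_orthogonal_eq_bot K.space

/-- If the span had dimension at most 2, all three planes would equal it, contradicting their
trivial intersection. -/
theorem dualLine_sup (K : IndependentPoints n) :
    (K.dualLine 0).toSubmodule ⊔ (K.dualLine 1).toSubmodule ⊔ (K.dualLine 2).toSubmodule =
      K.space := by
  have hle : ∀ i, (K.dualLine i).toSubmodule ≤ K.space := fun i => inf_le_left
  refine Submodule.eq_of_le_of_finrank_le (sup_le (sup_le (hle 0) (hle 1)) (hle 2)) ?_
  rw [finrank_space]
  by_contra! h
  have key : ∀ i, (K.dualLine i).toSubmodule = (K.dualLine 0).toSubmodule ⊔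
      (K.dualLine 1).toSubmodule ⊔ (K.dualLine 2).toSubmodule := fun i => by
    refine Submodule.eq_of_le_of_finrank_le ?_ ?_
    · fin_cases i
      · exact le_sup_left.trans le_sup_left
      · exact le_sup_right.trans le_sup_left
      · exact le_sup_right
    · rw [RealGrassmannian.finrank_toSubmodule]
      exact Nat.le_of_lt_succ h
  have h₁ := K.dualLine_inf_eq_bot
  rw [(key 1).trans (key 0).symm, (key 2).trans (key 0).symm, inf_idem, inf_idem] at h₁
  have h₂ := (K.dualLine 0).finrank_toSubmodule
  rw [h₁, finrank_bot] at h₂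
  exact two_ne_zero h₂.symm

/-- The triangle formed by the dual lines. -/
def toTriple (K : IndependentPoints n) : LineTriples n :=
  ⟨K.dualLine, (ProjLine.forms_triangle_iff K.dualLine).2
    ⟨by rw [dualLine_sup, finrank_space], K.dualLine_inf_eq_bot⟩⟩

theorem continuous_dualLine (i : Fin 3) :
    Continuous fun K : IndependentPoints n => K.dualLine i :=
  RealGrassmannian.continuous_iff.2 <|
    continuous_starProjection_inf_orthogonal (continuous_starProjection_point i)
      continuous_starProjection_space fun K => K.point_le_space i

theorem continuous_toTriple : Continuous (toTriple (n := n)) :=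
  continuous_induced_rng.2 (continuous_pi continuous_dualLine)

/-- The subspaces occurring in the Gram-Schmidt process deformed at time `t`. -/
def gramSchmidtPoint (t : ℝ) (K : IndependentPoints n) : Fin 3 → Submodule ℝ (AmbientSpace n) :=
  ![K.point 0, Submodule.tilt t (K.point 0) (K.point 1),
    Submodule.tilt t (K.point 0 ⊔ K.point 1) (K.point 2)]

theorem gramSchmidtPoint_sup (t : ℝ) (K : IndependentPoints n) :
    K.gramSchmidtPoint t 0 ⊔ K.gramSchmidtPoint t 1 ⊔ K.gramSchmidtPoint t 2 = K.space := by
  change K.point 0 ⊔ Submodule.tilt t (K.point 0) (K.point 1) ⊔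
    Submodule.tilt t (K.point 0 ⊔ K.point 1) (K.point 2) = _
  rw [Submodule.sup_tilt, Submodule.sup_tilt]
  rfl

/-- The linear deformation of a triple of independent points to the result of the Gram-Schmidt
process applied to it. -/
def gramSchmidt (t : ℝ) (K : IndependentPoints n) : IndependentPoints n where
  point := K.gramSchmidtPoint t
  finrank_point := by
    -- The three subspaces have dimension at most 1 and still span a 3-space, so each has dimension
    -- exactly 1.
    have h := K.finrank_space
    rw [← K.gramSchmidtPoint_sup t] at h
    have h₁ := Submodule.finrank_add_le_finrank_add_finrank
      (K.gramSchmidtPoint t 0) (K.gramSchmidtPoint t 1)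
    have h₂ := Submodule.finrank_add_le_finrank_add_finrank
      (K.gramSchmidtPoint t 0 ⊔ K.gramSchmidtPoint t 1) (K.gramSchmidtPoint t 2)
    have h₃ : Module.finrank ℝ (K.gramSchmidtPoint t 0) = 1 := K.finrank_point 0
    have h₄ : Module.finrank ℝ (K.gramSchmidtPoint t 1) ≤ 1 :=
      (Submodule.finrank_tilt_le _ _ _).trans (K.finrank_point 1).le
    have h₅ : Module.finrank ℝ (K.gramSchmidtPoint t 2) ≤ 1 :=
      (Submodule.finrank_tilt_le _ _ _).trans (K.finrank_point 2).le
    rw [Fin.forall_fin_succ, Fin.forall_fin_two]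
    refine ⟨h₃, ?_, ?_⟩
    · change Module.finrank ℝ (K.gramSchmidtPoint t 1) = 1
      omega
    · change Module.finrank ℝ (K.gramSchmidtPoint t 2) = 1
      omega
  finrank_sup := by rw [gramSchmidtPoint_sup, finrank_space]

@[simp]
theorem gramSchmidt_zero (K : IndependentPoints n) : K.gramSchmidt 0 = K := by
  refine ext_point fun i => ?_
  fin_cases i
  · rfl
  · exact Submodule.tilt_zero _ _
  · exact Submodule.tilt_zero _ _

theorem continuous_gramSchmidt :
    Continuous fun x : ℝ × IndependentPoints n => x.2.gramSchmidt x.1 := by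
  have h : ∀ i, Continuous fun x : ℝ × IndependentPoints n =>
      ((x.2.point i).starProjection : AmbientSpace n →L[ℝ] AmbientSpace n) :=
    fun i => (continuous_starProjection_point i).comp continuous_snd
  refine continuous_iff.2 fun i => ?_
  fin_cases i
  · exact h 0
  · exact continuous_starProjection_tilt continuous_fst (h 0) (h 1)
      fun x => (x.2.gramSchmidt x.1).finrank_point 1
  · exact continuous_starProjection_tilt continuous_fst
      (continuous_starProjection_sup_zero_one.comp continuous_snd) (h 2)
      fun x => (x.2.gramSchmidt x.1).finrank_point 2

end IndependentPoints

/-! ### Orthogonal frames of flags. -/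

namespace Flag123

variable {n : ℕ}

theorem V₁_le_V₂ (F : Flag123 n) : F.V₁ ≤ F.V₂ := F.2.1

theorem V₂_le_V₃ (F : Flag123 n) : F.V₂ ≤ F.V₃ := F.2.2

/-- The mutually orthogonal lines in the successive quotients of a flag. -/
def framePoint (F : Flag123 n) : Fin 3 → Submodule ℝ (AmbientSpace n) :=
  ![F.V₁, F.V₂ ⊓ F.V₁ᗮ, F.V₃ ⊓ F.V₂ᗮ]

theorem framePoint_sup_zero_one (F : Flag123 n) : F.framePoint 0 ⊔ F.framePoint 1 = F.V₂ :=
  Submodule.sup_inf_orthogonal F.V₁_le_V₂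

theorem framePoint_sup (F : Flag123 n) :
    F.framePoint 0 ⊔ F.framePoint 1 ⊔ F.framePoint 2 = F.V₃ := by
  rw [framePoint_sup_zero_one]
  exact Submodule.sup_inf_orthogonal F.V₂_le_V₃

/-- The orthogonal frame of points determined by a flag. -/
def frame (F : Flag123 n) : IndependentPoints n where
  point := F.framePoint
  finrank_point := by
    have h₁ : Module.finrank ℝ F.V₁ = 1 := F.1.1.2
    have h₂ : Module.finrank ℝ F.V₂ = 2 := F.1.2.1.2
    have h₃ : Module.finrank ℝ F.V₃ = 3 := F.1.2.2.2
    have h₄ := Submodule.finrank_inf_orthogonal_add_finrank F.V₁_le_V₂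
    have h₅ := Submodule.finrank_inf_orthogonal_add_finrank F.V₂_le_V₃
    rw [Fin.forall_fin_succ, Fin.forall_fin_two]
    refine ⟨h₁, ?_, ?_⟩
    · change Module.finrank ℝ (F.V₂ ⊓ F.V₁ᗮ : Submodule ℝ (AmbientSpace n)) = 1
      omega
    · change Module.finrank ℝ (F.V₃ ⊓ F.V₂ᗮ : Submodule ℝ (AmbientSpace n)) = 1
      omega
  finrank_sup := by
    rw [framePoint_sup]
    exact F.1.2.2.2

theorem space_frame (F : Flag123 n) : F.frame.space = F.V₃ := F.framePoint_sup

theorem continuous_frame : Continuous (frame (n := n)) := by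
  have h₁ : Continuous fun F : Flag123 n => F.V₁.starProjection :=
    RealGrassmannian.continuous_iff.1 (continuous_fst.comp continuous_subtype_val)
  have h₂ : Continuous fun F : Flag123 n => F.V₂.starProjection :=
    RealGrassmannian.continuous_iff.1
      (continuous_fst.comp (continuous_snd.comp continuous_subtype_val))
  have h₃ : Continuous fun F : Flag123 n => F.V₃.starProjection :=
    RealGrassmannian.continuous_iff.1
      (continuous_snd.comp (continuous_snd.comp continuous_subtype_val))
  refine IndependentPoints.continuous_iff.2 fun i => ?_
  fin_cases i
  · exact h₁
  · exact continuous_starProjection_inf_orthogonal h₁ h₂ V₁_le_V₂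
  · exact continuous_starProjection_inf_orthogonal h₂ h₃ V₂_le_V₃

theorem toFlag_frame (F : Flag123 n) : F.frame.toFlag = F :=
  Subtype.ext (Prod.ext rfl (Prod.ext (Subtype.ext F.framePoint_sup_zero_one)
    (Subtype.ext F.framePoint_sup)))

/-- Shows that the inverse map does not depend on the chosen orthonormal triple. -/
theorem frame_point_eq_span {F : Flag123 n} {e : Fin 3 → AmbientSpace n}
    (he : Orthonormal ℝ e) (hF : F.IsSpannedBy e) (i : Fin 3) :
    F.frame.point i = Submodule.span ℝ {e i} := by
  obtain ⟨h₁, h₂, h₃⟩ := hF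
  have horth : ∀ i j, i ≠ j → inner ℝ (e i) (e j) = 0 := fun i j h => he.2 h
  refine Submodule.eq_span_singleton_of_finrank_eq_one (F.frame.finrank_point i) ?_ (he.ne_zero i)
  fin_cases i
  · change e 0 ∈ F.V₁
    rw [h₁]
    exact Submodule.mem_span_singleton_self _
  · change e 1 ∈ F.V₂ ⊓ F.V₁ᗮ
    rw [h₁, h₂]
    refine ⟨Submodule.subset_span (by simp), ?_⟩
    exact Submodule.mem_orthogonal_singleton_iff_inner_right.2 (horth 0 1 (by decide))
  · change e 2 ∈ F.V₃ ⊓ F.V₂ᗮ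
    rw [h₂, h₃]
    refine ⟨Submodule.subset_span (by simp), ?_⟩
    rw [Submodule.span_insert, ← Submodule.inf_orthogonal]
    exact ⟨Submodule.mem_orthogonal_singleton_iff_inner_right.2 (horth 0 2 (by decide)),
      Submodule.mem_orthogonal_singleton_iff_inner_right.2 (horth 1 2 (by decide))⟩

end Flag123

theorem IndependentPoints.frame_toFlag {n : ℕ} (K : IndependentPoints n) :
    K.toFlag.frame = K.gramSchmidt 1 := by
  refine ext_point fun i => ?_
  fin_cases i
  · rfl
  · exact (Submodule.tilt_one _ _).symm
  · exact (Submodule.tilt_one _ _).symm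

/-! ### Duality for triangles, and the homotopy equivalence. -/

namespace LineTriples

variable {n : ℕ}

theorem line_le_commonSpace (p : LineTriples n) (i : Fin 3) : p.line i ≤ p.commonSpace :=
  le_iSup p.line i

theorem commonSpace_eq (p : LineTriples n) :
    p.commonSpace = p.line 0 ⊔ p.line 1 ⊔ p.line 2 := by
  refine le_antisymm (iSup_le fun i => ?_) (sup_le (sup_le ?_ ?_) ?_)
  · fin_cases i
    · exact le_sup_left.trans le_sup_left
    · exact le_sup_right.trans le_sup_left
    · exact le_sup_right
  all_goals exact p.line_le_commonSpace _

theorem finrank_commonSpace (p : LineTriples n) : Module.finrank ℝ p.commonSpace = 3 := by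
  rw [commonSpace_eq]
  exact ((ProjLine.forms_triangle_iff p.1).1 p.2).1

theorem line_inf_eq_bot (p : LineTriples n) : p.line 0 ⊓ p.line 1 ⊓ p.line 2 = ⊥ :=
  ((ProjLine.forms_triangle_iff p.1).1 p.2).2

theorem finrank_line (p : LineTriples n) (i : Fin 3) : Module.finrank ℝ (p.line i) = 2 :=
  (p.1 i).2

/-- Two lines suffice, and their sum exceeds the first by one dimension, as
`continuous_starProjection_sup` requires. -/
theorem line_sup_eq_commonSpace (p : LineTriples n) : p.line 0 ⊔ p.line 1 = p.commonSpace := by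
  refine Submodule.eq_of_le_of_finrank_le
    (sup_le (p.line_le_commonSpace 0) (p.line_le_commonSpace 1)) ?_
  have h₁ := Submodule.finrank_inf_eq_one_of_finrank_sup_eq_three (p.finrank_line 0)
    (p.finrank_line 1) (p.finrank_line 2) (p.commonSpace_eq ▸ p.finrank_commonSpace)
    p.line_inf_eq_bot
  have h₂ := Submodule.finrank_sup_add_finrank_inf_eq (p.line 0) (p.line 1)
  have := p.finrank_line 0
  have := p.finrank_line 1
  rw [finrank_commonSpace]
  omega

/-- The points dual to the lines of a triple. -/
def normalPoint (p : LineTriples n) (i : Fin 3) : Submodule ℝ (AmbientSpace n) :=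
  p.commonSpace ⊓ (p.line i)ᗮ

theorem commonSpace_inf_orthogonal_normalPoint (p : LineTriples n) (i : Fin 3) :
    p.commonSpace ⊓ (p.normalPoint i)ᗮ = p.line i :=
  Submodule.inf_orthogonal_inf_orthogonal (p.line_le_commonSpace i)

/-- Inside the common space, the complement of the span of the normals is the intersection of the
three lines, hence `⊥`. -/
theorem normalPoint_sup (p : LineTriples n) :
    p.normalPoint 0 ⊔ p.normalPoint 1 ⊔ p.normalPoint 2 = p.commonSpace := by
  have h : p.normalPoint 0 ⊔ p.normalPoint 1 ⊔ p.normalPoint 2 ≤ p.commonSpace :=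
    sup_le (sup_le inf_le_left inf_le_left) inf_le_left
  have h₁ := Submodule.sup_inf_orthogonal h
  rwa [← Submodule.inf_orthogonal, ← Submodule.inf_orthogonal, inf_inf_distrib_left _ (_ ⊓ _),
    inf_inf_distrib_left _ (p.normalPoint 0)ᗮ, commonSpace_inf_orthogonal_normalPoint,
    commonSpace_inf_orthogonal_normalPoint, commonSpace_inf_orthogonal_normalPoint,
    line_inf_eq_bot, sup_bot_eq] at h₁

/-- The triple of independent points dual to a triangle of lines. -/
def normals (p : LineTriples n) : IndependentPoints n where
  point := p.normalPoint
  finrank_point i := by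
    have h₁ := Submodule.finrank_inf_orthogonal_add_finrank (p.line_le_commonSpace i)
    rw [finrank_line, finrank_commonSpace] at h₁
    exact Nat.add_right_cancel h₁
  finrank_sup := by rw [normalPoint_sup, finrank_commonSpace]

theorem space_normals (p : LineTriples n) : p.normals.space = p.commonSpace := p.normalPoint_sup

theorem toTriple_normals (p : LineTriples n) : p.normals.toTriple = p := by
  refine Subtype.ext (funext fun i => Subtype.ext ?_)
  change p.normals.space ⊓ (p.normalPoint i)ᗮ = p.line i
  rw [space_normals, commonSpace_inf_orthogonal_normalPoint]

theorem continuous_normals : Continuous (normals (n := n)) := by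
  have h : ∀ i, Continuous fun p : LineTriples n => (p.line i).starProjection := fun i =>
    RealGrassmannian.continuous_iff.1 ((continuous_apply i).comp continuous_subtype_val)
  have hV : Continuous fun p : LineTriples n => p.commonSpace.starProjection := by
    simp_rw [← line_sup_eq_commonSpace]
    refine continuous_starProjection_sup (h 0) (h 1) fun p => ?_
    rw [line_sup_eq_commonSpace, finrank_commonSpace, finrank_line]
  exact IndependentPoints.continuous_iff.2 fun i =>
    continuous_starProjection_inf_orthogonal (h i) hV fun p => p.line_le_commonSpace i

theorem normals_toTriple (K : IndependentPoints n) : K.toTriple.normals = K := by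
  refine IndependentPoints.ext_point fun i => ?_
  have h : K.toTriple.commonSpace = K.space := K.toTriple.commonSpace_eq.trans K.dualLine_sup
  change K.toTriple.commonSpace ⊓ (K.space ⊓ (K.point i)ᗮ)ᗮ = K.point i
  rw [h, Submodule.inf_orthogonal_inf_orthogonal (K.point_le_space i)]

theorem IsNormalFrame.point_normals {p : LineTriples n} {e : Fin 3 → AmbientSpace n}
    (he : p.IsNormalFrame e) (i : Fin 3) : p.normals.point i = Submodule.span ℝ {e i} :=
  Submodule.eq_span_singleton_of_finrank_eq_one (p.normals.finrank_point i) (he i).2 (he i).1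

theorem IsNormalFrame.isSpannedBy {p : LineTriples n} {e : Fin 3 → AmbientSpace n}
    (he : p.IsNormalFrame e) : p.normals.toFlag.IsSpannedBy e := by
  have h₂ : p.normals.toFlag.V₂ = Submodule.span ℝ {e 0, e 1} := by
    rw [Submodule.span_insert, ← he.point_normals, ← he.point_normals]
    rfl
  have h₃ : p.normals.toFlag.V₃ = Submodule.span ℝ {e 0, e 1, e 2} := by
    rw [Submodule.span_insert, Submodule.span_insert, ← sup_assoc, ← he.point_normals,
      ← he.point_normals, ← he.point_normals]
    rfl
  exact ⟨he.point_normals 0, h₂, h₃⟩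

/-- The homotopy equivalence given by the Gram-Schmidt process for the normals of the lines. -/
def homotopyEquivFlag123 (n : ℕ) : LineTriples n ≃ₕ Flag123 n where
  toFun := ⟨fun p => p.normals.toFlag,
    IndependentPoints.continuous_toFlag.comp continuous_normals⟩
  invFun := ⟨fun F => F.frame.toTriple,
    IndependentPoints.continuous_toTriple.comp Flag123.continuous_frame⟩
  -- The deformation starts at the identity and ends at the composite, hence the `symm`.
  left_inv := Homotopic.symm ⟨{
    toFun := fun x => (x.2.normals.gramSchmidt x.1).toTriple
    continuous_toFun := IndependentPoints.continuous_toTriple.comp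
      (IndependentPoints.continuous_gramSchmidt.comp
        ((continuous_subtype_val.comp continuous_fst).prodMk
          (continuous_normals.comp continuous_snd)))
    map_zero_left := fun p => by simp [toTriple_normals]
    map_one_left := fun p => by simp [IndependentPoints.frame_toFlag] }⟩
  right_inv := by
    -- This composite is the identity on the nose.
    convert Homotopic.refl (ContinuousMap.id (Flag123 n)) using 1
    ext1 F
    change F.frame.toTriple.normals.toFlag = F
    rw [normals_toTriple, Flag123.toFlag_frame]

end LineTriples

end

theorem theorem5 (n : ℕ) :
    ∃ h : LineTriples n ≃ₕ Flag123 n,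
      (∀ (p : LineTriples n) (e : Fin 3 → AmbientSpace n),
        p.IsNormalFrame e → Flag123.IsSpannedBy (h.toFun p) e) ∧
      (∀ (F : Flag123 n) (e : Fin 3 → AmbientSpace n),
        Orthonormal ℝ e → F.IsSpannedBy e →
          ∀ i, LineTriples.line (h.invFun F) i = F.V₃ ⊓ (Submodule.span ℝ {e i})ᗮ) := by
  refine ⟨LineTriples.homotopyEquivFlag123 n, fun p e he => he.isSpannedBy, fun F e he hF i => ?_⟩
  change F.frame.space ⊓ (F.frame.point i)ᗮ = _
  rw [F.space_frame, Flag123.frame_point_eq_span he hF]
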